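/- Encode a rooted one-face map with $n\ge 1$ edges by a triple $(\alpha,\beta,\gamma)$ of permutations of the set $\{1,2,\dots,2n\}$ of half-edges, where $\alpha$ is an involution without fixed points (its cycles are the edges), $\gamma=(1,2,\dots,2n)$ is the long cycle (the unique boundary component, with root half-edge $1$), and $\gamma=\alpha\beta$ (the cycles of $\beta$, fixed points included, are the vertices). Two such triples $(\alpha,\beta,\gamma)$ and $(\alpha',\beta',\gamma')$ are equivalent if there is a permutation $\pi$ with $\alpha'=\pi\alpha\pi^{-1}$, $\gamma'=\pi\gamma\pi^{-1}$ and $\pi(1)=1$. The genus $g$ of the map is given by $v-n+1=2-2g$, where $v$ is the number of cycles of $\beta$. Let $A(n,g)$ be the number of equivalence classes of rooted one-face maps with $n$ edges and genus $g$. Then for every $n\ge 1$, all complex zeros of the polynomial $$H(x)=\sum_{g\ge 0}A(n,g)\,x^{\lfloor (n+1)/2\rfloor-g}$$ are real and non-positive, and the sequence $g\mapsto A(n,g)$ is log-concave, i.e. $$A(n,g)^2\ \ge\ A(n,g-1)\,A(n,g+1)\qquad\text{for all } g\ge 1 .$$ -/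

import Mathlib

/-- A one-face map (fatgraph with one boundary component) with `n` edges, encoded by a triple
`(α, β, γ)` of permutations of the `2 * n` half edges. The half edges are labelled
`0, 1, …, 2 * n - 1`, the label `0` being the root, in the order in which they occur along the
boundary. -/
@[ext]
structure RootedOneFaceMap (n : ℕ) where
  /-- the edges: a fixed-point free involution -/
  α : Equiv.Perm (Fin (2 * n))
  /-- the vertices: each cycle (fixed points included) is the cyclic order of the half edges
  at one vertex -/
  β : Equiv.Perm (Fin (2 * n))
  /-- the unique boundary component -/
  γ : Equiv.Perm (Fin (2 * n))
  involutive : α * α = 1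
  fixedPointFree : ∀ i, α i ≠ i
  γ_eq_longCycle : γ = finRotate (2 * n)
  γ_eq_mul : γ = α * β

namespace RootedOneFaceMap

/-- Two rooted one-face maps are equivalent if some permutation fixing the root label conjugates
the one to the other. -/
def Equivalent {n : ℕ} (m m' : RootedOneFaceMap n) : Prop :=
  ∃ π : Equiv.Perm (Fin (2 * n)),
    m'.α = π * m.α * π⁻¹ ∧ m'.γ = π * m.γ * π⁻¹ ∧ ∀ i : Fin (2 * n), (i : ℕ) = 0 → π i = i

/-- Equivalence of rooted one-face maps as a setoid. -/
def setoid (n : ℕ) : Setoid (RootedOneFaceMap n) where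
  r := Equivalent
  iseqv :=
    { refl := fun m => ⟨1, by simp, by simp, by simp⟩
      symm := by
        rintro m m' ⟨π, h1, h2, h3⟩
        refine ⟨π⁻¹, ?_, ?_, ?_⟩
        · rw [h1]; group
        · rw [h2]; group
        · intro i hi
          rw [Equiv.Perm.inv_eq_iff_eq]
          exact (h3 i hi).symm
      trans := by
        rintro m m' m'' ⟨π, h1, h2, h3⟩ ⟨π', h1', h2', h3'⟩
        refine ⟨π' * π, ?_, ?_, ?_⟩
        · rw [h1', h1]; group
        · rw [h2', h2]; group
        · intro i hi
          rw [Equiv.Perm.mul_apply, h3 i hi, h3' i hi] }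

/-- The number of vertices: the number of cycles of `β`, fixed points included. -/
noncomputable def numVertices {n : ℕ} (m : RootedOneFaceMap n) : ℕ :=
  Nat.card (Quotient (Equiv.Perm.SameCycle.setoid m.β))

/-- The genus is `g` when Euler's formula `v - n + 1 = 2 - 2 * g` holds. -/
def HasGenus {n : ℕ} (m : RootedOneFaceMap n) (g : ℕ) : Prop :=
  (m.numVertices : ℤ) - n + 1 = 2 - 2 * g

end RootedOneFaceMap

/-- `A(n, g)`: the number of equivalence classes of rooted one-face maps of genus `g` with
`n` edges. -/
noncomputable def oneFaceMapCount (n g : ℕ) : ℕ :=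
  Set.ncard {c : Quotient (RootedOneFaceMap.setoid n) |
    ∃ m : RootedOneFaceMap n, m.HasGenus g ∧ Quotient.mk (RootedOneFaceMap.setoid n) m = c}

/-- No one-face map with `n` edges has genus above `⌊(n + 1) / 2⌋`. -/
theorem oneFaceMapCount_eq_zero {n g : ℕ} (h : (n + 1) / 2 < g) : oneFaceMapCount n g = 0 := by
  have : {c : Quotient (RootedOneFaceMap.setoid n) |
      ∃ m : RootedOneFaceMap n, m.HasGenus g ∧
        Quotient.mk (RootedOneFaceMap.setoid n) m = c} = ∅ := by
    ext c
    simp only [Set.mem_ofPred_eq, Set.mem_empty_iff_false, iff_false]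
    rintro ⟨m, hm, -⟩
    unfold RootedOneFaceMap.HasGenus at hm
    omega
  rw [oneFaceMapCount, this, Set.ncard_empty]

/-- `H(x) = ∑_{g ≥ 0} A(n, g) x ^ (⌊(n + 1) / 2⌋ - g)`. The terms with `g > ⌊(n + 1) / 2⌋`
vanish by `oneFaceMapCount_eq_zero`, so no subtraction in the exponent is truncated. -/
noncomputable def oneFaceMapPoly (n : ℕ) : Polynomial ℝ :=
  ∑ g ∈ Finset.range ((n + 1) / 2 + 1),
    Polynomial.C (oneFaceMapCount n g : ℝ) * Polynomial.X ^ ((n + 1) / 2 - g)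

/-! Only the identity commutes with the long cycle and fixes the root, so equivalence is equality
and `A(n, g)` counts the fixed-point-free involutions `w` for which `w * γ` has `n + 1 - 2g` cycles.
All long cycles are conjugate, so the cycle distribution of `w * γ` over all `w` is the same for
every long cycle `γ`. Double counting pairs therefore allows `w` to be fixed and `γ` to vary.

For a fixed `w` on `N` points, let `L_w(q)` be the sum of `q ^ numCycles (w * γ)` over the long
cycles `γ`. Then `(1 - X)^(N+2) ∑_q L_w(q) X^q = (N-1)! X det(1 - X P_w)` (`longCycleSeries_eq`).
This goes by induction on `N`, adding one point: both sides obey the same recursion. For `N = 2n`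
and a fixed-point-free involution the determinant is `(1 - X^2)^n`, leaving `(2n-1)! X (1+X)^n /
(1-X)^(n+2)`. Up to a scalar this is the generating series of the values of `oneFaceRec n`
(`exists_sum_involutions_eq`).

The three-term recurrence keeps the ratio of consecutive polynomials in the open right half-plane
when `x` lies there. With parity, all zeros are purely imaginary (`re_eq_zero_of_aeval_oneFaceRec`).
Since `H(w^2)` is, up to a power of `w` and a positive scalar, `oneFaceRec n` at `w`, the zeros of
`H` are squares of imaginary numbers. Log-concavity follows by multiplying out the linear factors.
-/

/-! ### Cycle counts and the insertion of one point -/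

namespace Equiv.Perm

/-- The number of cycles of a permutation, fixed points included. -/
noncomputable def numCycles {α : Type*} (σ : Equiv.Perm α) : ℕ :=
  Nat.card (Quotient (SameCycle.setoid σ))

theorem SameCycle.apply_eq_of_invariant {α β : Type*} {σ : Equiv.Perm α} {f : α → β}
    (hf : ∀ x, f (σ x) = f x) {x y : α} (h : σ.SameCycle x y) : f x = f y := by
  obtain ⟨k, rfl⟩ := h
  have hinv : ∀ x, f (σ⁻¹ x) = f x := fun x => by
    rw [← hf (σ⁻¹ x)]; simp
  induction k using Int.induction_on with
  | zero => simp
  | succ i ih => rw [ih, add_comm, zpow_add, mul_apply, zpow_one, hf]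
  | pred i ih => rw [ih, sub_eq_add_neg, add_comm, zpow_add, mul_apply, zpow_neg_one, hinv]

theorem numCycles_conj {α β : Type*} (e : α ≃ β) (σ : Equiv.Perm α) :
    numCycles (e.permCongr σ) = numCycles σ := by
  refine Nat.card_congr (Equiv.symm ?_)
  refine Quotient.congr e fun x y => ?_
  constructor
  · intro h
    refine SameCycle.apply_eq_of_invariant (σ := σ)
      (f := fun x => (Quotient.mk (SameCycle.setoid (e.permCongr σ)) (e x))) ?_ h |> Quotient.exact
    intro x
    refine Quotient.sound (?_ : SameCycle _ _ _)
    have : e (σ x) = e.permCongr σ (e x) := by simp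
    rw [this]
    exact sameCycle_apply_left.2 (SameCycle.refl _ _)
  · intro h
    have := SameCycle.apply_eq_of_invariant (σ := e.permCongr σ)
      (f := fun x => (Quotient.mk (SameCycle.setoid σ) (e.symm x))) ?_ h
    · simpa using Quotient.exact this
    intro x
    refine Quotient.sound (?_ : SameCycle _ _ _)
    simpa using SameCycle.refl σ (e.symm x)

theorem numCycles_mul_comm {α : Type*} (σ τ : Equiv.Perm α) :
    numCycles (σ * τ) = numCycles (τ * σ) := by
  rw [← numCycles_conj τ (σ * τ)]
  congr 1
  ext x
  simp

theorem optionCongr_mul {α : Type*} (σ τ : Equiv.Perm α) :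
    optionCongr (σ * τ) = optionCongr σ * optionCongr τ := by
  ext1 x
  cases x <;> rfl

theorem numCycles_conj_mul {α : Type*} (π σ : Equiv.Perm α) :
    numCycles (π * σ * π⁻¹) = numCycles σ := by
  rw [numCycles_mul_comm, ← mul_assoc, inv_mul_cancel, one_mul]

theorem numCycles_pos {α : Type*} [Finite α] [Nonempty α] (σ : Equiv.Perm α) :
    0 < numCycles σ := by
  have : Nonempty (Quotient (SameCycle.setoid σ)) := ⟨Quotient.mk _ (Classical.arbitrary α)⟩
  exact Nat.card_pos

theorem numCycles_optionCongr {α : Type*} [Finite α] (σ : Equiv.Perm α) :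
    numCycles (optionCongr σ) = numCycles σ + 1 := by
  rw [numCycles, numCycles, ← Finite.card_option]
  have key : ∀ x : α, SameCycle (optionCongr σ) (some (σ x)) (some x) := fun x =>
    (sameCycle_apply_left (f := optionCongr σ) (x := some x)).2 (SameCycle.refl _ _)
  refine Nat.card_congr
    { toFun := Quotient.lift (fun x : Option α => x.map (Quotient.mk (SameCycle.setoid σ))) ?_
      invFun := fun c => c.elim (Quotient.mk _ none)
        (Quotient.lift (fun x => Quotient.mk _ (some x)) ?_)
      left_inv := ?_
      right_inv := ?_ }
  · intro a b h
    refine SameCycle.apply_eq_of_invariant ?_ h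
    rintro (_ | x)
    · rfl
    · simp only [optionCongr_apply, Option.map_some, Option.some.injEq]
      exact Quotient.sound (sameCycle_apply_left.2 (SameCycle.refl _ _))
  · intro a b h
    refine SameCycle.apply_eq_of_invariant (σ := σ)
      (f := fun x => Quotient.mk (SameCycle.setoid (optionCongr σ)) (some x)) (fun x => ?_) h
    exact Quotient.sound (key x)
  · intro c
    induction c using Quotient.inductionOn with
    | _ x => cases x <;> rfl
  · rintro (_ | c)
    · rfl
    · induction c using Quotient.inductionOn with
      | _ x => rfl

/-- The product inserts `none` into an existing cycle of `σ`, immediately before `y`. -/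
theorem numCycles_swap_mul_optionCongr {α : Type*} [DecidableEq α] (y : α)
    (σ : Equiv.Perm α) :
    numCycles (swap none (some y) * optionCongr σ) = numCycles σ := by
  set τ := swap none (some y) * optionCongr σ with hτ
  have hnone : τ none = some y := by simp [hτ]
  have hsome : ∀ x, σ x ≠ y → τ (some x) = some (σ x) := fun x hx => by
    simp [hτ, swap_apply_of_ne_of_ne, hx]
  have hsome' : ∀ x, σ x = y → τ (some x) = none := fun x hx => by simp [hτ, hx]
  refine Nat.card_congr
    { toFun := Quotient.lift (fun x : Option α =>
        Quotient.mk (SameCycle.setoid σ) (x.getD y)) ?_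
      invFun := Quotient.lift (fun x => Quotient.mk _ (some x)) ?_
      left_inv := ?_
      right_inv := ?_ }
  · intro a b h
    refine SameCycle.apply_eq_of_invariant (σ := τ)
      (f := fun x => Quotient.mk (SameCycle.setoid σ) (x.getD y)) ?_ h
    rintro (_ | x)
    · simp [hnone]
    · by_cases hx : σ x = y
      · rw [hsome' x hx, Option.getD_none, Option.getD_some, ← hx]
        exact Quotient.sound (sameCycle_apply_left.2 (SameCycle.refl _ _))
      · rw [hsome x hx]
        exact Quotient.sound (sameCycle_apply_left.2 (SameCycle.refl _ _))
  · intro a b h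
    refine SameCycle.apply_eq_of_invariant (σ := σ)
      (f := fun x => Quotient.mk (SameCycle.setoid τ) (some x)) (fun x => Quotient.sound ?_) h
    change SameCycle τ _ _
    by_cases hx : σ x = y
    · rw [hx, ← hnone, sameCycle_apply_left, ← hsome' x hx, sameCycle_apply_left]
    · rw [← hsome x hx, sameCycle_apply_left]
  · intro c
    induction c using Quotient.inductionOn with
    | _ x =>
      rcases x with _ | x
      · refine Quotient.sound (?_ : SameCycle τ _ _)
        rw [Option.getD_none, ← hnone, sameCycle_apply_left]
      · rfl
  · intro c
    induction c using Quotient.inductionOn with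
    | _ x => rfl

theorem numCycles_optionCongr_mul_swap_mul {α : Type*} [DecidableEq α] (y : α)
    (σ τ : Equiv.Perm α) :
    numCycles (optionCongr σ * swap none (some y) * optionCongr τ) = numCycles (σ * τ) := by
  rw [mul_assoc, numCycles_mul_comm, mul_assoc, ← optionCongr_mul,
    numCycles_swap_mul_optionCongr, numCycles_mul_comm]

end Equiv.Perm

/-! ### Sums over long cycles -/

namespace Equiv.Perm

variable {α : Type*} [Fintype α] [DecidableEq α]

/-- The permutations with exactly one cycle. -/
noncomputable def longCycles (α : Type*) [Fintype α] [DecidableEq α] : Finset (Equiv.Perm α) :=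
  {γ | numCycles γ = 1}

@[simp] theorem mem_longCycles {γ : Equiv.Perm α} : γ ∈ longCycles α ↔ numCycles γ = 1 := by
  simp [longCycles]

/-- The generating function of the number of cycles of `w * γ`, where `γ` runs over the
permutations with exactly one cycle. -/
noncomputable def longCycleSum (w : Equiv.Perm α) (q : ℚ) : ℚ :=
  ∑ γ ∈ longCycles α, q ^ numCycles (w * γ)

/-- A long cycle on one more point arises exactly once by inserting `none` before some `j` in a long
cycle. If `none` is fixed instead, there are at least two cycles. -/
theorem sum_longCycles_option [Nonempty α] (f : Equiv.Perm (Option α) → ℚ) :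
    ∑ γ ∈ longCycles (Option α), f γ =
      ∑ j : α, ∑ γ ∈ longCycles α, f (swap none (some j) * optionCongr γ) := by
  classical
  simp only [longCycles, Finset.sum_filter]
  rw [← decomposeOption.symm.sum_comp, Fintype.sum_prod_type, Fintype.sum_option]
  simp only [decomposeOption_symm_apply, numCycles_swap_mul_optionCongr, swap_self]
  rw [add_eq_right]
  refine Finset.sum_eq_zero fun γ _ => if_neg ?_
  have := numCycles_pos γ
  rw [← one_def, one_mul, numCycles_optionCongr]
  lia

theorem longCycleSum_optionCongr [Nonempty α] (v : Equiv.Perm α) (q : ℚ) :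
    longCycleSum (optionCongr v) q = Fintype.card α * longCycleSum v q := by
  rw [longCycleSum, sum_longCycles_option]
  simp only [← mul_assoc, numCycles_optionCongr_mul_swap_mul]
  rw [Finset.sum_const, Finset.card_univ, nsmul_eq_mul, longCycleSum]

theorem swap_none_mul_swap_none {α : Type*} [DecidableEq α] {j y : α} (h : j ≠ y) :
    (swap none (some y) * swap none (some j) : Equiv.Perm (Option α)) =
      optionCongr (swap y j) * swap none (some y) := by
  rw [optionCongr_swap]
  ext1 x
  rcases x with _ | x
  · simp [h, swap_apply_of_ne_of_ne]
  · by_cases hj : x = j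
    · subst hj; simp [h, swap_apply_of_ne_of_ne]
    · by_cases hy : x = y
      · subst hy; simp [h.symm, swap_apply_of_ne_of_ne]
      · simp [hj, hy, swap_apply_of_ne_of_ne]

/-- For `j = y` the two transpositions cancel and `none` is an extra fixed point, whence the factor
`q`. For `j ≠ y`, `swap_none_mul_swap_none` leaves a single transposition involving `none`, which
can be dropped without changing the cycle count. -/
theorem longCycleSum_optionCongr_mul_swap [Nonempty α] (v : Equiv.Perm α) (y : α) (q : ℚ) :
    longCycleSum (optionCongr v * swap none (some y)) q =
      q * longCycleSum v q + ∑ j ∈ Finset.univ.erase y, longCycleSum (v * swap y j) q := by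
  rw [longCycleSum, sum_longCycles_option, ← Finset.add_sum_erase _ _ (Finset.mem_univ y)]
  congr 1
  · rw [longCycleSum, Finset.mul_sum]
    refine Finset.sum_congr rfl fun γ _ => ?_
    rw [mul_assoc, ← mul_assoc (swap _ _), swap_mul_self, one_mul, ← optionCongr_mul,
      numCycles_optionCongr, pow_succ']
  · refine Finset.sum_congr rfl fun j hj => ?_
    refine Finset.sum_congr rfl fun γ _ => ?_
    rw [mul_assoc, ← mul_assoc (swap _ _), swap_none_mul_swap_none (Finset.ne_of_mem_erase hj),
      ← mul_assoc, ← mul_assoc, ← optionCongr_mul, numCycles_optionCongr_mul_swap_mul]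

theorem longCycleSum_permCongr {β : Type*} [Fintype β] [DecidableEq β] (e : α ≃ β)
    (w : Equiv.Perm α) (q : ℚ) : longCycleSum (e.permCongr w) q = longCycleSum w q := by
  simp only [longCycleSum, longCycles, Finset.sum_filter]
  rw [← e.permCongr.sum_comp]
  refine Finset.sum_congr rfl fun γ _ => ?_
  rw [numCycles_conj, ← permCongr_mul, numCycles_conj]

end Equiv.Perm

/-! ### Determinants: derivations and two-row updates -/

theorem Derivation.map_finset_prod {R A ι : Type*} [CommRing R] [CommRing A] [Algebra R A]
    [DecidableEq ι] (D : Derivation R A A) (s : Finset ι) (f : ι → A) :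
    D (∏ i ∈ s, f i) = ∑ i ∈ s, ∏ k ∈ s, Function.update f i (D (f i)) k := by
  induction s using Finset.induction_on with
  | empty => simp
  | insert a s ha ih =>
    rw [Finset.prod_insert ha, D.leibniz, ih, Finset.sum_insert ha, Finset.prod_insert ha,
      Function.update_self, smul_eq_mul, smul_eq_mul, add_comm, Finset.mul_sum]
    congr 1
    · rw [mul_comm]
      congr 1
      refine Finset.prod_congr rfl fun k hk => ?_
      rw [Function.update_of_ne (ne_of_mem_of_not_mem hk ha)]
    · refine Finset.sum_congr rfl fun i hi => ?_
      rw [Finset.prod_insert ha, Function.update_of_ne (ne_of_mem_of_not_mem hi ha).symm]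

theorem Derivation.map_det {R A n : Type*} [CommRing R] [CommRing A] [Algebra R A]
    [DecidableEq n] [Fintype n] (D : Derivation R A A) (M : Matrix n n A) :
    D M.det = ∑ i, (M.updateCol i fun r => D (M r i)).det := by
  simp only [Matrix.det_apply, map_sum]
  rw [Finset.sum_comm]
  refine Finset.sum_congr rfl fun σ _ => ?_
  rw [← Finset.smul_sum, Units.smul_def, Units.smul_def, map_zsmul, D.map_finset_prod]
  congr 1
  refine Finset.sum_congr rfl fun i _ => Finset.prod_congr rfl fun k _ => ?_
  by_cases h : k = i
  · subst h; simp
  · simp [h]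

namespace Matrix

variable {n R : Type*} [DecidableEq n] [Fintype n] [CommRing R]

theorem det_updateRow_updateRow_swap (M : Matrix n n R) {y j : n} (h : y ≠ j) (a b : n → R) :
    ((M.updateRow y a).updateRow j b).det = -((M.updateRow y b).updateRow j a).det := by
  have hz : ∀ c, ((M.updateRow y c).updateRow j c).det = 0 := fun c =>
    det_zero_of_row_eq h (by simp [updateRow_ne h])
  have := hz (a + b)
  rw [det_updateRow_add, updateRow_comm _ h, updateRow_comm _ h, det_updateRow_add,
    det_updateRow_add, ← updateRow_comm _ h, ← updateRow_comm _ h, ← updateRow_comm _ h,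
    ← updateRow_comm _ h, hz, hz] at this
  linear_combination this

theorem det_updateRow_sub (M : Matrix n n R) (j : n) (u v : n → R) :
    (M.updateRow j (u - v)).det = (M.updateRow j u).det - (M.updateRow j v).det := by
  rw [eq_sub_iff_add_eq, ← det_updateRow_add, sub_add_cancel]

/-- Bilinear expansion in rows `y` and `j`: the term with `f` in both rows vanishes, and those with
`f` once are adjugate entries. This is the shape in which `cycleMatrix_mul_swap` presents the effect
of a transposition. -/
theorem det_updateRow_updateRow_single (M : Matrix n n R) {y j : n} (h : y ≠ j) :
    ((M.updateRow y (Pi.single y 1 - Pi.single j 1 + M j)).updateRow j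
        (M y - (Pi.single y 1 - Pi.single j 1))).det =
      -M.det + M.adjugate j j + M.adjugate y y - M.adjugate j y - M.adjugate y j := by
  set f : n → R := Pi.single y 1 - Pi.single j 1 with hf
  have hff : ((M.updateRow y f).updateRow j f).det = 0 :=
    det_zero_of_row_eq h (by simp [updateRow_ne h])
  have h1 : ∀ b, ((M.updateRow y (M y)).updateRow j b).det = (M.updateRow j b).det := fun b => by
    rw [updateRow_eq_self]
  have h2 : ∀ a, ((M.updateRow y a).updateRow j (M j)).det = (M.updateRow y a).det := fun a => by
    rw [updateRow_comm _ h, updateRow_eq_self]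
  have h3 : ((M.updateRow y (M j)).updateRow j (M y)).det = -M.det := by
    rw [det_updateRow_updateRow_swap _ h, updateRow_eq_self, updateRow_eq_self]
  rw [det_updateRow_sub, updateRow_comm _ h, det_updateRow_add, ← updateRow_comm _ h,
    ← updateRow_comm _ h, h3, updateRow_comm _ h (f + M j) f, det_updateRow_add,
    ← updateRow_comm _ h, ← updateRow_comm _ h, hff, det_updateRow_updateRow_swap _ h f, h1,
    det_updateRow_updateRow_swap _ h (M j) f, h2, hf, det_updateRow_sub, det_updateRow_sub,
    adjugate_apply, adjugate_apply, adjugate_apply, adjugate_apply]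
  ring

end Matrix

/-! ### The determinant of `1 - t P_w` under transpositions -/

namespace Equiv.Perm

open Matrix

variable {α R : Type*} [DecidableEq α] [CommRing R]

/-- The matrix `1 - t P`, where `P` is the permutation matrix of `w`. -/
def cycleMatrix (t : R) (w : Equiv.Perm α) : Matrix α α R :=
  Matrix.of fun i => Pi.single i 1 - t • Pi.single (w i) 1

theorem cycleMatrix_row (t : R) (w : Equiv.Perm α) (i : α) :
    cycleMatrix t w i = Pi.single i 1 - t • Pi.single (w i) 1 := rfl

theorem cycleMatrix_apply (t : R) (w : Equiv.Perm α) (i j : α) :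
    cycleMatrix t w i j = (if j = i then 1 else 0) - (if j = w i then t else 0) := by
  simp [cycleMatrix_row, Pi.single_apply]

theorem cycleMatrix_mul_swap (t : R) (v : Equiv.Perm α) {y j : α} (h : y ≠ j) :
    cycleMatrix t (v * swap y j) =
      ((cycleMatrix t v).updateRow y (Pi.single y 1 - Pi.single j 1 + cycleMatrix t v j)).updateRow
        j (cycleMatrix t v y - (Pi.single y 1 - Pi.single j 1)) := by
  refine funext fun i => ?_
  by_cases hj : i = j
  · subst hj
    rw [updateRow_self, cycleMatrix_row, cycleMatrix_row, mul_apply, swap_apply_right]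
    abel
  · rw [updateRow_ne hj]
    by_cases hy : i = y
    · subst hy
      rw [updateRow_self, cycleMatrix_row, cycleMatrix_row, mul_apply, swap_apply_left]
      abel
    · rw [updateRow_ne hy, cycleMatrix_row, cycleMatrix_row, mul_apply,
        swap_apply_of_ne_of_ne hy hj]

variable [Fintype α]

theorem det_cycleMatrix_mul_swap (t : R) (v : Equiv.Perm α) {y j : α} (h : y ≠ j) :
    (cycleMatrix t (v * swap y j)).det =
      -(cycleMatrix t v).det + (cycleMatrix t v).adjugate j j + (cycleMatrix t v).adjugate y y
        - (cycleMatrix t v).adjugate j y - (cycleMatrix t v).adjugate y j := by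
  rw [cycleMatrix_mul_swap t v h, det_updateRow_updateRow_single _ h]

theorem sum_cycleMatrix_row (t : R) (v : Equiv.Perm α) (i : α) :
    ∑ j, cycleMatrix t v i j = 1 - t := by
  simp [cycleMatrix_apply, Finset.sum_sub_distrib]

theorem sum_cycleMatrix_col (t : R) (v : Equiv.Perm α) (j : α) :
    ∑ i, cycleMatrix t v i j = 1 - t := by
  simp only [cycleMatrix_apply, Finset.sum_sub_distrib]
  rw [Equiv.sum_comp v fun i => if j = i then t else 0]
  simp

/-- The all-ones vector is an eigenvector with eigenvalue `1 - t`; apply `adj M * M = det M • 1` to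
it. -/
theorem sum_adjugate_cycleMatrix_row (t : R) (v : Equiv.Perm α) (y : α) :
    (1 - t) * ∑ b, (cycleMatrix t v).adjugate y b = (cycleMatrix t v).det := by
  have h := congrArg (fun A : Matrix α α R => ∑ j, A y j) (adjugate_mul (cycleMatrix t v))
  simp only [Matrix.mul_apply, Matrix.smul_apply, Matrix.one_apply, smul_eq_mul, mul_ite,
    mul_one, mul_zero, Finset.sum_ite_eq, Finset.mem_univ, if_true] at h
  rw [Finset.sum_comm] at h
  simp only [← Finset.mul_sum, sum_cycleMatrix_row] at h
  rw [← Finset.sum_mul, mul_comm] at h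
  exact h

theorem sum_adjugate_cycleMatrix_col (t : R) (v : Equiv.Perm α) (y : α) :
    (1 - t) * ∑ b, (cycleMatrix t v).adjugate b y = (cycleMatrix t v).det := by
  have h := congrArg (fun A : Matrix α α R => ∑ j, A j y) (mul_adjugate (cycleMatrix t v))
  simp only [Matrix.mul_apply, Matrix.smul_apply, Matrix.one_apply, smul_eq_mul, mul_ite,
    mul_one, mul_zero, Finset.sum_ite_eq', Finset.mem_univ, if_true] at h
  rw [Finset.sum_comm] at h
  simp only [← Finset.sum_mul, sum_cycleMatrix_col] at h
  rw [← Finset.mul_sum] at h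
  exact h

theorem sum_det_cycleMatrix_mul_swap (t : R) (v : Equiv.Perm α) (y : α) :
    (1 - t) * ∑ j ∈ Finset.univ.erase y, (cycleMatrix t (v * swap y j)).det =
      (1 - t) * (-(Fintype.card α - 1) * (cycleMatrix t v).det + (cycleMatrix t v).adjugate.trace
        + Fintype.card α * (cycleMatrix t v).adjugate y y) - 2 * (cycleMatrix t v).det := by
  set M := cycleMatrix t v
  -- At `j = y` the summand on the right is `-M.det`, so extending the sum to all `j` costs `+
  -- M.det`.
  have h1 : ∑ j ∈ Finset.univ.erase y, (cycleMatrix t (v * swap y j)).det =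
      ∑ j, (-M.det + M.adjugate j j + M.adjugate y y - M.adjugate j y - M.adjugate y j)
        + M.det := by
    rw [← Finset.add_sum_erase _ _ (Finset.mem_univ y)]
    rw [Finset.sum_congr rfl fun j hj =>
      det_cycleMatrix_mul_swap t v (Finset.ne_of_mem_erase hj).symm]
    ring
  rw [h1]
  simp only [Finset.sum_sub_distrib, Finset.sum_add_distrib, Finset.sum_const, Finset.card_univ,
    nsmul_eq_mul, Matrix.trace, Matrix.diag]
  linear_combination -sum_adjugate_cycleMatrix_row t v y - sum_adjugate_cycleMatrix_col t v y

theorem det_cycleMatrix_optionCongr (t : R) (v : Equiv.Perm α) :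
    (cycleMatrix t (optionCongr v)).det = (1 - t) * (cycleMatrix t v).det := by
  rw [← det_submatrix_equiv_self (optionEquivSumPUnit.{0, _} α).symm]
  have : (cycleMatrix t (optionCongr v)).submatrix (optionEquivSumPUnit.{0, _} α).symm
      (optionEquivSumPUnit.{0, _} α).symm = fromBlocks (cycleMatrix t v) 0 0
        (Matrix.of fun _ _ : PUnit.{1} => 1 - t) := by
    ext i j
    rcases i with i | i <;> rcases j with j | j <;> simp [cycleMatrix_apply]
  rw [this, det_fromBlocks_zero₂₁, det_unique (Matrix.of _), of_apply, mul_comm]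

theorem det_cycleMatrix_optionCongr_mul_swap (t : R) (v : Equiv.Perm α) (y : α) :
    (cycleMatrix t (optionCongr v * swap none (some y))).det =
      t * (cycleMatrix t v).det + (1 - t) * (cycleMatrix t v).adjugate y y := by
  rw [← det_submatrix_equiv_self (optionEquivSumPUnit.{0, _} α).symm]
  have : (cycleMatrix t (optionCongr v * swap none (some y))).submatrix
      (optionEquivSumPUnit.{0, _} α).symm (optionEquivSumPUnit.{0, _} α).symm =
      fromBlocks ((cycleMatrix t v).updateRow y (Pi.single y 1))
        (Matrix.of fun i _ => if i = y then -t else 0)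
        (Matrix.of fun _ j => if j = v y then -t else 0) (1 : Matrix PUnit.{1} PUnit.{1} R) := by
    ext i j
    rcases i with i | i <;> rcases j with j | j
    · by_cases h : i = y
      · subst h; simp [cycleMatrix_apply, Pi.single_apply]
      · simp [cycleMatrix_apply, h, swap_apply_of_ne_of_ne]
    · by_cases h : i = y
      · subst h; simp [cycleMatrix_apply]
      · simp [cycleMatrix_apply, h, swap_apply_of_ne_of_ne]
    · by_cases h : j = v y <;> simp [cycleMatrix_apply, h]
    · simp [cycleMatrix_apply]
  rw [this, det_fromBlocks_one₂₂, adjugate_apply]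
  -- The Schur complement changes only row `y`, to `e_y - t² e_{v y} = (1 - t) e_y + t (e_y - t e_{v
  -- y})`.
  have h2 : (cycleMatrix t v).updateRow y (Pi.single y 1) -
      (Matrix.of fun i (_ : PUnit.{1}) => if i = y then -t else 0) *
        (Matrix.of fun (_ : PUnit.{1}) j => if j = v y then -t else 0) =
      (cycleMatrix t v).updateRow y ((1 - t) • Pi.single y 1 + t • cycleMatrix t v y) := by
    ext i j
    by_cases h : i = y
    · subst h
      by_cases h1 : j = i <;> by_cases h2 : j = v i <;>
        simp [Matrix.mul_apply, cycleMatrix_apply, Pi.single_apply, h1, h2] <;> split_ifs <;> ring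
    · simp [Matrix.mul_apply, h]
  rw [h2, det_updateRow_add, det_updateRow_smul, det_updateRow_smul, updateRow_eq_self]
  ring

theorem det_cycleMatrix_permCongr {β : Type*} [Fintype β] [DecidableEq β] (t : R) (e : α ≃ β)
    (w : Equiv.Perm α) : (cycleMatrix t (e.permCongr w)).det = (cycleMatrix t w).det := by
  rw [← det_submatrix_equiv_self e]
  congr 1
  ext i j
  simp [cycleMatrix_apply]

open PowerSeries in
-- Entrywise `X M' = M - 1`, so differentiating column `i` contributes `det M` minus the `i`-th
-- diagonal adjugate entry. This removes the trace appearing in `sum_det_cycleMatrix_mul_swap`.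
theorem X_mul_derivative_det_cycleMatrix (w : Equiv.Perm α) :
    (X : ℚ⟦X⟧) * d⁄dX ℚ (cycleMatrix (X : ℚ⟦X⟧) w).det =
      Fintype.card α * (cycleMatrix (X : ℚ⟦X⟧) w).det
        - (cycleMatrix (X : ℚ⟦X⟧) w).adjugate.trace := by
  set M := cycleMatrix (X : ℚ⟦X⟧) w with hM
  rw [Derivation.map_det, Finset.mul_sum, Matrix.trace, ← nsmul_eq_mul, ← Finset.card_univ,
    ← Finset.sum_const, ← Finset.sum_sub_distrib]
  refine Finset.sum_congr rfl fun i _ => ?_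
  rw [← det_updateCol_smul]
  have : (X : ℚ⟦X⟧) • (fun r => d⁄dX ℚ (M r i)) = (fun r => M r i) + (-1 : ℚ⟦X⟧) • Pi.single i 1 := by
    ext1 r
    simp only [hM, cycleMatrix_apply, Pi.smul_apply, Pi.add_apply, smul_eq_mul, Pi.single_apply,
      eq_comm (a := r)]
    split_ifs <;> (simp; try ring)
  rw [this, det_updateCol_add, det_updateCol_smul, updateCol_eq_self, diag_apply, adjugate_def,
    of_apply, cramer_transpose_apply, ← adjugate_apply]
  rw [← cramer_apply, cramer_eq_adjugate_mulVec]
  simp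
  ring

end Equiv.Perm

/-! ### The generating series of the long-cycle sums -/

namespace Equiv.Perm

open PowerSeries

/-- The power series whose coefficient at `q` is `longCycleSum w q`. -/
noncomputable def longCycleSeries {α : Type*} [Fintype α] [DecidableEq α] (w : Equiv.Perm α) :
    ℚ⟦X⟧ :=
  PowerSeries.mk fun q => longCycleSum w q

theorem X_mul_derivative_mk (f : ℕ → ℚ) :
    (X : ℚ⟦X⟧) * d⁄dX ℚ (PowerSeries.mk f) = PowerSeries.mk fun q => q * f q := by
  ext q
  rcases q with _ | q
  · simp
  · rw [coeff_succ_X_mul, coeff_derivative, coeff_mk, coeff_mk]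
    push_cast
    ring

section

variable {α : Type*} [Fintype α] [DecidableEq α] [Nonempty α]

theorem longCycleSeries_optionCongr (v : Equiv.Perm α) :
    longCycleSeries (optionCongr v) = Fintype.card α * longCycleSeries v := by
  ext q
  rw [← nsmul_eq_mul, map_nsmul, longCycleSeries, longCycleSeries, coeff_mk, coeff_mk,
    longCycleSum_optionCongr, nsmul_eq_mul]

theorem longCycleSeries_optionCongr_mul_swap (v : Equiv.Perm α) (y : α) :
    longCycleSeries (optionCongr v * swap none (some y)) = X * d⁄dX ℚ (longCycleSeries v)
      + ∑ j ∈ Finset.univ.erase y, longCycleSeries (v * swap y j) := by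
  rw [longCycleSeries, longCycleSeries, X_mul_derivative_mk]
  ext q
  simp only [map_add, map_sum, coeff_mk, longCycleSum_optionCongr_mul_swap, longCycleSeries]

theorem exists_eq_optionCongr_or {α : Type*} [DecidableEq α] (w : Equiv.Perm (Option α)) :
    ∃ v : Equiv.Perm α, w = optionCongr v ∨ ∃ y, w = optionCongr v * swap none (some y) := by
  -- `decomposeOption` puts the transposition on the left; inverting moves it to the right.
  obtain ⟨⟨i, e⟩, h⟩ := decomposeOption.symm.surjective w⁻¹
  rw [decomposeOption_symm_apply] at h
  have h2 : w = (optionCongr e)⁻¹ * swap none i := by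
    rw [← inv_inv w, ← h, mul_inv_rev, swap_inv]
  refine ⟨e⁻¹, ?_⟩
  rcases i with _ | y
  · left
    rw [h2, swap_self]
    rfl
  · right
    exact ⟨y, h2⟩

end

theorem longCycleSeries_permCongr {α β : Type*} [Fintype α] [DecidableEq α] [Fintype β]
    [DecidableEq β] (e : α ≃ β) (w : Equiv.Perm α) :
    longCycleSeries (e.permCongr w) = longCycleSeries w := by
  simp only [longCycleSeries, longCycleSum_permCongr]

theorem one_sub_X_sq_mul_mk_natCast :
    (1 - X) ^ 2 * (PowerSeries.mk fun q : ℕ => (q : ℚ)) = X := by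
  have h1 : (PowerSeries.mk fun _ => 1 : ℚ⟦X⟧) * (1 - X) = 1 := mk_one_mul_one_sub_eq_one ℚ
  have h2 := X_mul_derivative_mk fun _ => 1
  have h3 := congrArg (d⁄dX ℚ) h1
  simp only [Derivation.leibniz, map_sub, Derivation.map_one_eq_zero, derivative_X,
    smul_eq_mul] at h3
  simp only [mul_one] at h2
  rw [← h2]
  linear_combination X * (1 - X) * h3 + X * h1

theorem longCycleSeries_of_unique {α : Type*} [Fintype α] [DecidableEq α] [Unique α]
    (w : Equiv.Perm α) : (1 - X) ^ 2 * longCycleSeries w = X := by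
  have hc : ∀ σ : Equiv.Perm α, numCycles σ = 1 := fun σ =>
    Nat.card_eq_one_iff_unique.2 ⟨⟨fun a b => by
      induction a using Quotient.inductionOn with
      | _ a =>
        induction b using Quotient.inductionOn with
        | _ b => rw [Subsingleton.elim a b]⟩, ⟨Quotient.mk _ default⟩⟩
  have h : longCycleSeries w = PowerSeries.mk fun q : ℕ => (q : ℚ) := by
    ext q
    simp [longCycleSeries, longCycleSum, longCycles, hc]
  rw [h, one_sub_X_sq_mul_mk_natCast]

theorem longCycleSeries_eq_option {α : Type*} [Fintype α] [DecidableEq α] [Nonempty α] {d : ℕ}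
    (hd : Fintype.card α = d + 1)
    (ih : ∀ v : Equiv.Perm α, (1 - X) ^ (d + 3) * longCycleSeries v =
      (d.factorial : ℚ⟦X⟧) * X * (cycleMatrix (X : ℚ⟦X⟧) v).det)
    (w : Equiv.Perm (Option α)) :
    (1 - X) ^ (d + 4) * longCycleSeries w =
      ((d + 1).factorial : ℚ⟦X⟧) * X * (cycleMatrix (X : ℚ⟦X⟧) w).det := by
  rw [Nat.factorial_succ, Nat.cast_mul]
  obtain ⟨v, rfl | ⟨y, rfl⟩⟩ := exists_eq_optionCongr_or w
  · rw [longCycleSeries_optionCongr, det_cycleMatrix_optionCongr, hd]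
    linear_combination (1 - X) * ((d + 1 : ℕ) : ℚ⟦X⟧) * ih v
  · rw [longCycleSeries_optionCongr_mul_swap, det_cycleMatrix_optionCongr_mul_swap]
    have ihv := ih v
    have hderiv := congrArg (d⁄dX ℚ) ihv
    have htr := X_mul_derivative_det_cycleMatrix v
    have hsum := sum_det_cycleMatrix_mul_swap (X : ℚ⟦X⟧) v y
    have hs : (1 - X) ^ (d + 3) * ∑ j ∈ Finset.univ.erase y, longCycleSeries (v * swap y j) =
        (d.factorial : ℚ⟦X⟧) * X *
          ∑ j ∈ Finset.univ.erase y, (cycleMatrix (X : ℚ⟦X⟧) (v * swap y j)).det := by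
      rw [Finset.mul_sum, Finset.mul_sum]
      exact Finset.sum_congr rfl fun j _ => ih _
    simp only [Derivation.leibniz, Derivation.leibniz_pow, map_sub, Derivation.map_one_eq_zero,
      Derivation.map_natCast, derivative_X, smul_eq_mul, nsmul_eq_mul, hd,
      show d + 3 - 1 = d + 2 from rfl] at hderiv htr hsum
    push_cast at *
    -- The trace cancels between `hsum` and `htr`; the remaining diagonal entry at `y` has
    -- coefficient `d + 1`, which raises `d!` to `(d + 1)!`.
    linear_combination (1 - X) * X * hderiv + X * (d + 3) * ihv + (1 - X) * hs +
      (d.factorial : ℚ⟦X⟧) * X * hsum + (d.factorial : ℚ⟦X⟧) * X * (1 - X) * htr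

/-- The cycle distribution of the products of a fixed permutation with all long cycles. -/
theorem longCycleSeries_eq (α : Type*) [Fintype α] [DecidableEq α] [Nonempty α]
    (w : Equiv.Perm α) :
    (1 - X) ^ (Fintype.card α + 2) * longCycleSeries w =
      ((Fintype.card α - 1).factorial : ℚ⟦X⟧) * X * (cycleMatrix (X : ℚ⟦X⟧) w).det := by
  refine Fintype.induction_empty_option (P := fun α _ => ∀ [DecidableEq α] [Nonempty α]
    (w : Equiv.Perm α), (1 - X) ^ (Fintype.card α + 2) * longCycleSeries w =
      ((Fintype.card α - 1).factorial : ℚ⟦X⟧) * X * (cycleMatrix (X : ℚ⟦X⟧) w).det)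
    ?_ ?_ ?_ α w
  · intro α β _ e h _ _ w
    classical
    let := Fintype.ofEquiv β e.symm
    have : Nonempty α := e.nonempty
    have := h (e.symm.permCongr w)
    rw [longCycleSeries_permCongr, det_cycleMatrix_permCongr] at this
    rw [← Fintype.card_congr e]
    exact this
  · intro _ h
    exact h.elim fun x => x.elim
  · intro α _ ih hdec _ w
    let := Classical.decEq α
    obtain rfl : hdec = Option.instDecidableEq := Subsingleton.elim _ _
    -- The true base case is one point, reached when `α` is empty.
    rcases isEmpty_or_nonempty α with hα | hα
    · have h1 : cycleMatrix (X : ℚ⟦X⟧) w none none = 1 - X := by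
        rw [cycleMatrix_apply, if_pos rfl, if_pos (Subsingleton.elim _ _)]
      have : Unique (Option α) := Option.instUniqueOfIsEmpty
      rw [Matrix.det_eq_elem_of_subsingleton _ none, h1, Fintype.card_option,
        Fintype.card_eq_zero, zero_add, pow_succ', mul_assoc,
        longCycleSeries_of_unique]
      simp [mul_comm]
    · obtain ⟨d, hd⟩ : ∃ d, Fintype.card α = d + 1 :=
        Nat.exists_eq_succ_of_ne_zero Fintype.card_ne_zero
      rw [Fintype.card_option, hd]
      simp only [hd, Nat.add_sub_cancel] at ih ⊢
      exact longCycleSeries_eq_option hd (fun v => ih v) w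

end Equiv.Perm

/-! ### Fixed-point-free involutions and the Harer–Zagier polynomials -/

namespace Equiv.Perm

open PowerSeries

section

variable {α : Type*} [Fintype α] [DecidableEq α]

/-- The involutions without fixed points. -/
def fixedPointFreeInvolutions (α : Type*) [Fintype α] [DecidableEq α] :
    Finset (Equiv.Perm α) :=
  {w | w * w = 1 ∧ ∀ i, w i ≠ i}

@[simp] theorem mem_fixedPointFreeInvolutions {w : Equiv.Perm α} :
    w ∈ fixedPointFreeInvolutions α ↔ w * w = 1 ∧ ∀ i, w i ≠ i := by
  simp [fixedPointFreeInvolutions]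

theorem conj_mem_fixedPointFreeInvolutions {w : Equiv.Perm α} (π : Equiv.Perm α)
    (hw : w ∈ fixedPointFreeInvolutions α) : π * w * π⁻¹ ∈ fixedPointFreeInvolutions α := by
  rw [mem_fixedPointFreeInvolutions] at hw ⊢
  refine ⟨by rw [_root_.conj_mul, hw.1, mul_one, mul_inv_cancel], fun i h => hw.2 (π⁻¹ i) ?_⟩
  rw [Equiv.Perm.eq_inv_iff_eq]
  exact h

theorem cycleType_of_mem_fixedPointFreeInvolutions {n : ℕ} (hα : Fintype.card α = 2 * n)
    {w : Equiv.Perm α} (hw : w ∈ fixedPointFreeInvolutions α) :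
    w.cycleType = Multiset.replicate n 2 := by
  rw [mem_fixedPointFreeInvolutions] at hw
  have h2 : ∀ c ∈ w.cycleType, c = 2 :=
    (pow_prime_eq_one_iff (p := 2)).1 (by rw [pow_two, hw.1])
  have hs : w.support = Finset.univ :=
    Finset.eq_univ_of_forall fun i => mem_support.2 (hw.2 i)
  have h3 := Multiset.eq_replicate_of_mem h2
  have h4 := w.sum_cycleType
  rw [hs, Finset.card_univ, hα, h3, Multiset.sum_replicate, smul_eq_mul] at h4
  rw [h3]
  congr 1
  lia

theorem permCongr_sumComm_mem {n : ℕ} (e : Fin n ⊕ Fin n ≃ α) :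
    e.permCongr (Equiv.sumComm (Fin n) (Fin n)) ∈ fixedPointFreeInvolutions α := by
  rw [mem_fixedPointFreeInvolutions]
  constructor
  · ext1 x
    simp
  · intro i
    obtain ⟨x, rfl⟩ := e.surjective i
    cases x <;> simp

/-- Cycle type determines the conjugacy class; the model exchanging two copies of `Fin n` turns the
determinant into a 2 × 2 block computation. -/
theorem exists_permCongr_sumComm {n : ℕ} (hα : Fintype.card α = 2 * n) {w : Equiv.Perm α}
    (hw : w ∈ fixedPointFreeInvolutions α) :
    ∃ e : Fin n ⊕ Fin n ≃ α, w = e.permCongr (Equiv.sumComm (Fin n) (Fin n)) := by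
  have e₀ : Fin n ⊕ Fin n ≃ α := Fintype.equivOfCardEq (by simp [hα, two_mul])
  have hc : IsConj (e₀.permCongr (Equiv.sumComm (Fin n) (Fin n))) w := by
    rw [isConj_iff_cycleType_eq, cycleType_of_mem_fixedPointFreeInvolutions hα hw,
      cycleType_of_mem_fixedPointFreeInvolutions hα (permCongr_sumComm_mem e₀)]
  obtain ⟨π, hπ⟩ := isConj_iff.1 hc
  refine ⟨e₀.trans π, ?_⟩
  rw [← hπ]
  ext x
  simp

theorem fixedPointFreeInvolutions_nonempty {n : ℕ} (hα : Fintype.card α = 2 * n) :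
    (fixedPointFreeInvolutions α).Nonempty := by
  have e : Fin n ⊕ Fin n ≃ α := Fintype.equivOfCardEq (by simp [hα, two_mul])
  exact ⟨_, permCongr_sumComm_mem e⟩

theorem det_cycleMatrix_sumComm {R : Type*} [CommRing R] (t : R) (n : ℕ) :
    (cycleMatrix t (Equiv.sumComm (Fin n) (Fin n) : Equiv.Perm (Fin n ⊕ Fin n))).det =
      (1 - t ^ 2) ^ n := by
  have : cycleMatrix t (Equiv.sumComm (Fin n) (Fin n) : Equiv.Perm (Fin n ⊕ Fin n)) =
      Matrix.fromBlocks 1 (-t • (1 : Matrix (Fin n) (Fin n) R)) (-t • 1) 1 := by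
    ext i j
    rcases i with i | i <;> rcases j with j | j <;>
      simp [cycleMatrix_apply, Matrix.one_apply, eq_comm (a := i)]
  rw [this, Matrix.det_fromBlocks_one₂₂]
  have h2 : (1 : Matrix (Fin n) (Fin n) R) - (-t • 1) * (-t • 1) =
      (1 - t ^ 2) • (1 : Matrix (Fin n) (Fin n) R) := by
    rw [smul_mul_smul_comm, one_mul, sub_smul, one_smul]
    congr 2
    ring
  rw [h2, Matrix.det_smul, Matrix.det_one, mul_one, Fintype.card_fin]

theorem one_sub_X_pow_mul_longCycleSeries {n : ℕ} (hn : 1 ≤ n) (hα : Fintype.card α = 2 * n)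
    {w : Equiv.Perm α} (hw : w ∈ fixedPointFreeInvolutions α) :
    (1 - X) ^ (n + 2) * longCycleSeries w =
      ((2 * n - 1).factorial : ℚ⟦X⟧) * (X * (1 + X) ^ n) := by
  have : Nonempty α := Fintype.card_pos_iff.1 (by lia)
  obtain ⟨e, he⟩ := exists_permCongr_sumComm hα hw
  have h := longCycleSeries_eq α w
  rw [show (cycleMatrix (X : ℚ⟦X⟧) w).det = (1 - X ^ 2) ^ n by
    rw [he, det_cycleMatrix_permCongr, det_cycleMatrix_sumComm], hα] at h
  have h1 : (1 - X : ℚ⟦X⟧) ≠ 0 := by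
    intro h0
    simpa using congrArg (constantCoeff (R := ℚ)) h0
  refine mul_left_cancel₀ (pow_ne_zero n h1) ?_
  have h3 : (1 - X ^ 2 : ℚ⟦X⟧) ^ n = (1 - X) ^ n * (1 + X) ^ n := by
    rw [← mul_pow]
    ring
  rw [h3] at h
  linear_combination h

end

/-- The polynomials of the three-term recurrence
`(n + 3) p (n + 2) = 2 x p (n + 1) + (n + 1) p n`. -/
noncomputable def oneFaceRec : ℕ → Polynomial ℚ
  | 0 => Polynomial.X
  | 1 => Polynomial.X ^ 2
  | n + 2 => Polynomial.C ((n + 3 : ℚ)⁻¹) *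
      (2 * Polynomial.X * oneFaceRec (n + 1) + Polynomial.C (n + 1 : ℚ) * oneFaceRec n)

theorem mk_eval_oneFaceRec (n : ℕ) :
    (1 - X) ^ (n + 2) * (PowerSeries.mk fun q : ℕ => (oneFaceRec n).eval (q : ℚ)) =
      X * (1 + X) ^ n := by
  induction n using Nat.twoStepInduction with
  | zero => simpa [oneFaceRec] using one_sub_X_sq_mul_mk_natCast
  | one =>
    have h1 := one_sub_X_sq_mul_mk_natCast
    have h2 := X_mul_derivative_mk fun q => q
    have h3 := congrArg (d⁄dX ℚ) h1
    simp only [Derivation.leibniz, Derivation.leibniz_pow, map_sub, Derivation.map_one_eq_zero,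
      derivative_X, smul_eq_mul, nsmul_eq_mul] at h3
    simp only [oneFaceRec, Polynomial.eval_pow, Polynomial.eval_X, pow_two (_ : ℚ)]
    rw [← h2]
    norm_num at h3
    linear_combination X * (1 - X) * h3 + 2 * X * h1
  | more n ih0 ih1 =>
    have h2 := X_mul_derivative_mk fun q : ℕ => (oneFaceRec (n + 1)).eval (q : ℚ)
    have h3 := congrArg (d⁄dX ℚ) ih1
    have h4 : ((n + 3 : ℕ) : ℚ⟦X⟧) *
        (PowerSeries.mk fun q : ℕ => (oneFaceRec (n + 2)).eval (q : ℚ)) =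
        2 * (PowerSeries.mk fun q : ℕ => (q : ℚ) * (oneFaceRec (n + 1)).eval (q : ℚ)) +
          ((n + 1 : ℕ) : ℚ⟦X⟧) * PowerSeries.mk fun q : ℕ => (oneFaceRec n).eval (q : ℚ) := by
      ext q
      rw [← nsmul_eq_mul, ← nsmul_eq_mul, ← Nat.cast_ofNat (R := ℚ⟦X⟧), ← nsmul_eq_mul]
      rw [map_add, map_nsmul, map_nsmul, map_nsmul]
      simp only [coeff_mk, oneFaceRec, nsmul_eq_mul, Polynomial.eval_mul, Polynomial.eval_add,
        Polynomial.eval_C, Polynomial.eval_X, Polynomial.eval_ofNat]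
      push_cast
      field_simp
    have h5 : ((n + 3 : ℕ) : ℚ⟦X⟧) ≠ 0 := fun h0 =>
      Nat.cast_ne_zero.2 (Nat.succ_ne_zero (n + 2))
        (by simpa only [map_natCast, map_zero] using congrArg (constantCoeff (R := ℚ)) h0)
    refine mul_left_cancel₀ h5 ?_
    rw [mul_left_comm, h4, ← h2]
    simp only [Derivation.leibniz, Derivation.leibniz_pow, map_sub, map_add,
      Derivation.map_one_eq_zero, derivative_X, smul_eq_mul, nsmul_eq_mul,
      Nat.add_sub_cancel, show n + 1 + 2 - 1 = n + 2 from rfl] at h3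
    push_cast at *
    linear_combination 2 * X * (1 - X) * h3 + 2 * X * (n + 3) * ih1 + (n + 1) * (1 - X) ^ 2 * ih0

theorem longCycleSum_eq {α : Type*} [Fintype α] [DecidableEq α] {n : ℕ} (hn : 1 ≤ n)
    (hα : Fintype.card α = 2 * n) {w : Equiv.Perm α} (hw : w ∈ fixedPointFreeInvolutions α)
    (q : ℕ) : longCycleSum w q = (2 * n - 1).factorial * (oneFaceRec n).eval (q : ℚ) := by
  have h1 : (1 - X : ℚ⟦X⟧) ≠ 0 := by
    intro h0
    simpa using congrArg (constantCoeff (R := ℚ)) h0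
  have h : longCycleSeries w = ((2 * n - 1).factorial : ℚ⟦X⟧) *
      PowerSeries.mk fun q : ℕ => (oneFaceRec n).eval (q : ℚ) := by
    refine mul_left_cancel₀ (pow_ne_zero (n + 2) h1) ?_
    rw [one_sub_X_pow_mul_longCycleSeries hn hα hw, mul_left_comm ((1 - X : ℚ⟦X⟧) ^ _),
      mk_eval_oneFaceRec]
  have := congrArg (coeff q) h
  rwa [longCycleSeries, coeff_mk, ← nsmul_eq_mul, map_nsmul, coeff_mk, nsmul_eq_mul] at this

section

variable {α : Type*} [Fintype α] [DecidableEq α] [Nontrivial α]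

theorem mem_longCycles_iff {γ : Equiv.Perm α} :
    γ ∈ longCycles α ↔ γ.IsCycle ∧ γ.support = Finset.univ := by
  rw [mem_longCycles, numCycles, Nat.card_eq_one_iff_unique]
  constructor
  · rintro ⟨h, -⟩
    have hsame : ∀ x y, γ.SameCycle x y := fun x y =>
      Quotient.exact (h.elim (Quotient.mk (SameCycle.setoid γ) x) (Quotient.mk _ y))
    have hne : ∀ x, γ x ≠ x := fun x hx => by
      obtain ⟨y, hy⟩ := exists_ne x
      obtain ⟨k, hk⟩ := hsame x y
      rw [zpow_apply_eq_self_of_apply_eq_self hx] at hk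
      exact hy hk.symm
    obtain ⟨a⟩ := (inferInstance : Nonempty α)
    exact ⟨⟨a, hne a, fun y _ => hsame a y⟩,
      Finset.eq_univ_of_forall fun i => mem_support.2 (hne i)⟩
  · rintro ⟨h, hs⟩
    have hne : ∀ x, γ x ≠ x := fun x => mem_support.1 (hs ▸ Finset.mem_univ x)
    refine ⟨⟨fun a b => ?_⟩, ⟨Quotient.mk _ (Classical.arbitrary α)⟩⟩
    induction a using Quotient.inductionOn with
    | _ a =>
      induction b using Quotient.inductionOn with
      | _ b => exact Quotient.sound (h.sameCycle (hne a) (hne b))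

theorem isConj_of_mem_longCycles {γ γ' : Equiv.Perm α} (h : γ ∈ longCycles α)
    (h' : γ' ∈ longCycles α) : IsConj γ γ' := by
  rw [mem_longCycles_iff] at h h'
  exact h.1.isConj h'.1 (by rw [h.2, h'.2])

theorem sum_involutions_eq {γ γ' : Equiv.Perm α} (h : γ ∈ longCycles α)
    (h' : γ' ∈ longCycles α) (q : ℚ) :
    ∑ w ∈ fixedPointFreeInvolutions α, q ^ numCycles (w * γ) =
      ∑ w ∈ fixedPointFreeInvolutions α, q ^ numCycles (w * γ') := by
  obtain ⟨π, rfl⟩ := isConj_iff.1 (isConj_of_mem_longCycles h h')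
  refine Finset.sum_bij' (fun w _ => π * w * π⁻¹) (fun w _ => π⁻¹ * w * π⁻¹⁻¹)
    (fun w hw => conj_mem_fixedPointFreeInvolutions _ hw)
    (fun w hw => conj_mem_fixedPointFreeInvolutions _ hw)
    (fun w _ => by group) (fun w _ => by group) fun w _ => ?_
  rw [← numCycles_conj_mul π (w * γ)]
  congr 2
  group

/-- The Harer–Zagier formula, up to a positive factor. -/
theorem exists_sum_involutions_eq {n : ℕ} (hn : 1 ≤ n) (hα : Fintype.card α = 2 * n)
    {γ : Equiv.Perm α} (hγ : γ ∈ longCycles α) :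
    ∃ K : ℚ, 0 < K ∧
      ∑ w ∈ fixedPointFreeInvolutions α, (Polynomial.X : Polynomial ℚ) ^ numCycles (w * γ) =
        Polynomial.C K * oneFaceRec n := by
  have hL : (0 : ℚ) < (longCycles α).card := Nat.cast_pos.2 (Finset.card_pos.2 ⟨γ, hγ⟩)
  have hF : (0 : ℚ) < (fixedPointFreeInvolutions α).card :=
    Nat.cast_pos.2 (Finset.card_pos.2 (fixedPointFreeInvolutions_nonempty hα))
  have hfac : (0 : ℚ) < (2 * n - 1).factorial := Nat.cast_pos.2 (Nat.factorial_pos _)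
  -- The constant comes from summing over all pairs (involution, long cycle) in both orders; the
  -- identity is then checked at every natural `q`.
  refine ⟨(fixedPointFreeInvolutions α).card * (2 * n - 1).factorial / (longCycles α).card,
    by positivity, ?_⟩
  refine Polynomial.eq_of_infinite_eval_eq _ _
    (Set.Infinite.mono ?_ (Set.infinite_range_of_injective (Nat.cast_injective (R := ℚ))))
  rintro _ ⟨q, rfl⟩
  have h1 : ∑ γ' ∈ longCycles α, ∑ w ∈ fixedPointFreeInvolutions α,
      (q : ℚ) ^ numCycles (w * γ') =
      (longCycles α).card * ∑ w ∈ fixedPointFreeInvolutions α, (q : ℚ) ^ numCycles (w * γ) := by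
    rw [Finset.sum_congr rfl fun γ' h' => sum_involutions_eq h' hγ (q : ℚ), Finset.sum_const,
      nsmul_eq_mul]
  have h2 : ∑ γ' ∈ longCycles α, ∑ w ∈ fixedPointFreeInvolutions α,
      (q : ℚ) ^ numCycles (w * γ') = (fixedPointFreeInvolutions α).card *
        ((2 * n - 1).factorial * (oneFaceRec n).eval (q : ℚ)) := by
    rw [Finset.sum_comm, ← nsmul_eq_mul, ← Finset.sum_const]
    exact Finset.sum_congr rfl fun w hw => longCycleSum_eq hn hα hw q
  simp only [Set.mem_ofPred_eq, Polynomial.eval_finsetSum, Polynomial.eval_pow,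
    Polynomial.eval_X, Polynomial.eval_mul, Polynomial.eval_C]
  rw [h2] at h1
  field_simp
  linear_combination -h1

end

end Equiv.Perm

/-! ### Log-concavity from real non-positive zeros -/

open Polynomial in
/-- A real polynomial with positive leading coefficient all of whose complex zeros are real and
non-positive has non-negative log-concave coefficients. -/
theorem Polynomial.coeff_nonneg_and_logConcave_of_roots (P : ℝ[X]) (hlead : 0 < P.leadingCoeff)
    (hroots : ∀ z : ℂ, aeval z P = 0 → ∃ r : ℝ, r ≤ 0 ∧ z = (r : ℂ)) :
    (∀ i, 0 ≤ P.coeff i) ∧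
      ∀ i j, i ≤ j → P.coeff i * P.coeff (j + 1) ≤ P.coeff (i + 1) * P.coeff j := by
  -- Each step multiplies by `X + s` with `s ≥ 0`. The two-index inequality, unlike its consecutive
  -- case, carries through even if coefficients vanish.
  induction hd : P.natDegree generalizing P with
  | zero =>
    rw [natDegree_eq_zero] at hd
    obtain ⟨c, rfl⟩ := hd
    rw [leadingCoeff_C] at hlead
    refine ⟨fun i => ?_, fun i j _ => ?_⟩
    · rw [coeff_C]
      split_ifs
      exacts [hlead.le, le_rfl]
    · simp [coeff_C]
  | succ d ih =>
    obtain ⟨z, hz⟩ := IsAlgClosed.exists_aeval_eq_zero ℂ P fun h => by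
      have := natDegree_eq_of_degree_eq_some (n := 0) h
      lia
    obtain ⟨r, hr, rfl⟩ := hroots z hz
    have hroot : P.IsRoot r := by
      have : ((P.eval r : ℝ) : ℂ) = 0 := by
        rw [← hz]
        exact (aeval_algebraMap_apply_eq_algebraMap_eval r P).symm
      exact_mod_cast this
    obtain ⟨Q, rfl⟩ := dvd_iff_isRoot.2 hroot
    rw [leadingCoeff_mul, leadingCoeff_X_sub_C, one_mul] at hlead
    have hQ : Q ≠ 0 := fun h => by simp [h] at hlead
    rw [natDegree_mul (X_sub_C_ne_zero r) hQ, natDegree_X_sub_C] at hd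
    obtain ⟨h0, h1⟩ := ih Q hlead (fun z hz => hroots z (by rw [map_mul, hz, mul_zero])) (by lia)
    have hc0 : ((X - C r) * Q).coeff 0 = -r * Q.coeff 0 := by
      rw [sub_mul, coeff_sub, coeff_X_mul_zero, coeff_C_mul]
      ring
    have hc : ∀ k, ((X - C r) * Q).coeff (k + 1) = Q.coeff k + -r * Q.coeff (k + 1) := fun k => by
      rw [sub_mul, coeff_sub, coeff_X_mul, coeff_C_mul]
      ring
    obtain ⟨s, rfl⟩ : ∃ s, r = -s := ⟨-r, by ring⟩
    rw [neg_neg] at hc0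
    simp only [neg_neg] at hc
    have hs : 0 ≤ s := by linarith
    refine ⟨fun i => ?_, fun i j hij => ?_⟩
    · rcases i with _ | i
      · rw [hc0]
        exact mul_nonneg hs (h0 _)
      · rw [hc]
        exact add_nonneg (h0 _) (mul_nonneg hs (h0 _))
    · rcases i with _ | i
      · rcases j with _ | j
        · rw [mul_comm]
        · rw [hc0, hc, hc, hc]
          have e1 := mul_le_mul_of_nonneg_left (h1 0 (j + 1) (by lia)) (mul_nonneg hs hs)
          have e2 := mul_nonneg (h0 0) (h0 j)
          have e3 := mul_nonneg hs (mul_nonneg (h0 1) (h0 j))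
          rw [zero_add] at e1 ⊢
          linarith
      · obtain ⟨j, rfl⟩ : ∃ k, j = k + 1 := ⟨j - 1, by lia⟩
        rw [hc, hc, hc, hc]
        have e1 := h1 i j (by lia)
        have e2 := mul_le_mul_of_nonneg_left (h1 (i + 1) (j + 1) hij) (mul_nonneg hs hs)
        have e3 : Q.coeff i * Q.coeff (j + 2) ≤ Q.coeff (i + 2) * Q.coeff j := by
          rcases eq_or_lt_of_le hij with h | h
          · obtain rfl : i = j := by lia
            rw [mul_comm]
          · exact (h1 i (j + 1) (by lia)).trans (h1 (i + 1) j (by lia))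
        have e4 := mul_le_mul_of_nonneg_left e3 hs
        linarith

/-! ### Zeros of the recurrence polynomials -/

namespace Equiv.Perm

open Polynomial

theorem coeff_oneFaceRec_ne_zero {n k : ℕ} (h : (oneFaceRec n).coeff k ≠ 0) :
    ∃ g, k + 2 * g = n + 1 := by
  induction n using Nat.twoStepInduction generalizing k with
  | zero =>
    rw [oneFaceRec, coeff_X] at h
    exact ⟨0, by split_ifs at h <;> simp_all⟩
  | one =>
    rw [oneFaceRec, coeff_X_pow] at h
    exact ⟨0, by split_ifs at h <;> simp_all⟩
  | more n ih0 ih1 =>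
    rw [oneFaceRec, coeff_C_mul, coeff_add, coeff_C_mul, mul_assoc, ← C_ofNat, coeff_C_mul] at h
    by_cases h0 : (oneFaceRec n).coeff k = 0
    · rcases k with _ | k
      · simp [h0] at h
      · rw [coeff_X_mul, h0] at h
        obtain ⟨g, hg⟩ := ih1 (k := k) fun h1 => h (by rw [h1]; simp)
        exact ⟨g, by lia⟩
    · obtain ⟨g, hg⟩ := ih0 h0
      exact ⟨g + 1, by lia⟩

theorem aeval_oneFaceRec_add_two (n : ℕ) (z : ℂ) :
    (n + 3) * aeval z (oneFaceRec (n + 2)) =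
      2 * z * aeval z (oneFaceRec (n + 1)) + (n + 1) * aeval z (oneFaceRec n) := by
  have : (n + 3 : ℂ) ≠ 0 := by exact_mod_cast Nat.succ_ne_zero (n + 2)
  simp only [oneFaceRec, map_mul, map_add, aeval_C, aeval_X, map_ofNat, eq_ratCast]
  push_cast
  field_simp

/-- Dividing the recurrence by the middle term writes the next ratio as a positive combination of
`z` and the inverse of the current ratio, and inversion preserves the right half-plane. -/
theorem aeval_oneFaceRec_ne_zero {z : ℂ} (hz : 0 < z.re) (n : ℕ) :
    aeval z (oneFaceRec n) ≠ 0 ∧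
      0 < (aeval z (oneFaceRec (n + 1)) / aeval z (oneFaceRec n)).re := by
  have hz0 : z ≠ 0 := fun h => by simp [h] at hz
  induction n with
  | zero =>
    simp only [oneFaceRec, map_pow, aeval_X]
    exact ⟨hz0, by rwa [pow_two, mul_div_cancel_right₀ _ hz0]⟩
  | succ n ih =>
    obtain ⟨h0, h1⟩ := ih
    have h2 : aeval z (oneFaceRec (n + 1)) ≠ 0 := fun h => by simp [h] at h1
    refine ⟨h2, ?_⟩
    have h3 := aeval_oneFaceRec_add_two n z
    set u := aeval z (oneFaceRec n)
    set v := aeval z (oneFaceRec (n + 1))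
    set w := aeval z (oneFaceRec (n + 2))
    have h4 : w / v = ((n + 3 : ℝ)⁻¹ : ℝ) * (((2 : ℝ) : ℂ) * z + ((n + 1 : ℝ) : ℂ) * (v / u)⁻¹) := by
      have : (n + 3 : ℂ) ≠ 0 := by exact_mod_cast Nat.succ_ne_zero (n + 2)
      push_cast
      field_simp
      linear_combination h3
    have h5 : 0 < (v / u)⁻¹.re := by
      rw [Complex.inv_re]
      exact div_pos h1 (Complex.normSq_pos.2 (div_ne_zero h2 h0))
    rw [h4, Complex.re_ofReal_mul, Complex.add_re, Complex.re_ofReal_mul, Complex.re_ofReal_mul]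
    positivity

theorem aeval_neg_oneFaceRec (z : ℂ) (n : ℕ) :
    aeval (-z) (oneFaceRec n) = (-1) ^ (n + 1) * aeval z (oneFaceRec n) := by
  induction n using Nat.twoStepInduction with
  | zero => simp [oneFaceRec]
  | one => simp [oneFaceRec]
  | more n ih0 ih1 =>
    have : (n + 3 : ℂ) ≠ 0 := by exact_mod_cast Nat.succ_ne_zero (n + 2)
    refine mul_left_cancel₀ this ?_
    rw [aeval_oneFaceRec_add_two, mul_left_comm, aeval_oneFaceRec_add_two, ih0, ih1]
    ring

theorem re_eq_zero_of_aeval_oneFaceRec {z : ℂ} {n : ℕ} (h : aeval z (oneFaceRec n) = 0) :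
    z.re = 0 := by
  rcases lt_trichotomy z.re 0 with hz | hz | hz
  · refine absurd ?_ (aeval_oneFaceRec_ne_zero (z := -z) (by simpa using hz) n).1
    rw [aeval_neg_oneFaceRec, h, mul_zero]
  · exact hz
  · exact absurd h (aeval_oneFaceRec_ne_zero hz n).1

theorem finRotate_mem_longCycles {m : ℕ} (hm : 2 ≤ m) : finRotate m ∈ longCycles (Fin m) := by
  obtain ⟨k, rfl⟩ : ∃ k, m = k + 2 := ⟨m - 2, by lia⟩
  exact mem_longCycles_iff.2 ⟨isCycle_finRotate, support_finRotate⟩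

end Equiv.Perm

/-! ### From maps to involutions -/

namespace RootedOneFaceMap

open Equiv.Perm Polynomial

variable {n : ℕ}

theorem equivalent_iff (hn : 1 ≤ n) (m m' : RootedOneFaceMap n) : m.Equivalent m' ↔ m = m' := by
  refine ⟨?_, fun h => h ▸ (setoid n).refl m⟩
  rintro ⟨π, h1, h2, h3⟩
  have hπ : π = 1 := by
    rw [m.γ_eq_longCycle, m'.γ_eq_longCycle, eq_mul_inv_iff_mul_eq] at h2
    have hcomm : ∀ i, π (finRotate _ i) = finRotate _ (π i) := fun i =>
      (Equiv.congr_fun h2 i).symm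
    ext1 i
    have hlong := mem_longCycles.1 (finRotate_mem_longCycles (m := 2 * n) (by lia))
    have hsame : (finRotate (2 * n)).SameCycle ⟨0, by lia⟩ i := by
      have := (Nat.card_eq_one_iff_unique.1 hlong).1
      exact Quotient.exact (this.elim (Quotient.mk (SameCycle.setoid _) _) (Quotient.mk _ i))
    obtain ⟨k, hk⟩ := hsame
    have hc : Commute π (finRotate (2 * n) ^ k) := Commute.zpow_right h2.symm k
    -- Every label is a power of the rotation applied to the root, and `π` commutes with that power.
    rw [one_apply, ← hk, ← mul_apply, hc.eq, mul_apply, h3 _ rfl]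
  subst hπ
  have hα : m'.α = m.α := by rw [h1]; simp
  have hγ : m'.γ = m.γ := by rw [h2]; simp
  refine RootedOneFaceMap.ext hα.symm ?_ hγ.symm
  have h5 := m.γ_eq_mul
  rw [← hγ, m'.γ_eq_mul, hα] at h5
  exact (mul_left_cancel h5).symm

theorem β_eq (m : RootedOneFaceMap n) : m.β = m.α * finRotate (2 * n) := by
  rw [← m.γ_eq_longCycle, m.γ_eq_mul, ← mul_assoc, m.involutive, one_mul]

theorem α_injective : Function.Injective (α : RootedOneFaceMap n → _) := fun m m' h =>
  RootedOneFaceMap.ext h (by rw [β_eq, β_eq, h]) (by rw [m.γ_eq_longCycle, m'.γ_eq_longCycle])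

end RootedOneFaceMap

open Equiv.Perm Polynomial

theorem oneFaceMapCount_eq_card {n : ℕ} (hn : 1 ≤ n) (g : ℕ) :
    oneFaceMapCount n g = {w ∈ fixedPointFreeInvolutions (Fin (2 * n)) |
      numCycles (w * finRotate (2 * n)) + 2 * g = n + 1}.card := by
  have h1 : {c : Quotient (RootedOneFaceMap.setoid n) |
      ∃ m : RootedOneFaceMap n, m.HasGenus g ∧ Quotient.mk (RootedOneFaceMap.setoid n) m = c} =
      Quotient.mk (RootedOneFaceMap.setoid n) '' {m | m.HasGenus g} := rfl
  have hinj : Function.Injective (Quotient.mk (RootedOneFaceMap.setoid n)) := fun m m' h =>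
    (RootedOneFaceMap.equivalent_iff hn m m').1 (Quotient.exact h)
  rw [oneFaceMapCount, h1, Set.ncard_image_of_injective _ hinj,
    ← Set.ncard_image_of_injective _ RootedOneFaceMap.α_injective, ← Set.ncard_coe_finset]
  congr 1
  have hgenus : ∀ m : RootedOneFaceMap n, m.HasGenus g ↔
      numCycles (m.α * finRotate (2 * n)) + 2 * g = n + 1 := fun m => by
    rw [RootedOneFaceMap.HasGenus, RootedOneFaceMap.numVertices, m.β_eq]
    change ((numCycles (m.α * finRotate (2 * n)) : ℕ) : ℤ) - n + 1 = 2 - 2 * g ↔ _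
    lia
  ext w
  simp only [Set.mem_image, Set.mem_ofPred_eq, hgenus, Finset.coe_filter,
    mem_fixedPointFreeInvolutions]
  constructor
  · rintro ⟨m, hm, rfl⟩
    exact ⟨⟨m.involutive, m.fixedPointFree⟩, hm⟩
  · rintro ⟨⟨h1, h2⟩, h3⟩
    exact ⟨⟨w, w * finRotate (2 * n), finRotate (2 * n), h1, h2, rfl,
      by rw [← mul_assoc, h1, one_mul]⟩, h3, rfl⟩

theorem exists_oneFaceMapCount_eq {n : ℕ} (hn : 1 ≤ n) :
    ∃ K : ℚ, 0 < K ∧ ∀ g k : ℕ, k + 2 * g = n + 1 →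
      (oneFaceMapCount n g : ℚ) = K * (oneFaceRec n).coeff k := by
  have : Nontrivial (Fin (2 * n)) := Fin.nontrivial_iff_two_le.2 (by lia)
  obtain ⟨K, hK, h⟩ := exists_sum_involutions_eq hn (Fintype.card_fin _)
    (finRotate_mem_longCycles (m := 2 * n) (by lia))
  refine ⟨K, hK, fun g k hk => ?_⟩
  rw [← coeff_C_mul, ← h, finsetSum_coeff, oneFaceMapCount_eq_card hn, Finset.card_filter]
  push_cast
  refine Finset.sum_congr rfl fun w _ => ?_
  rw [coeff_X_pow]
  exact if_congr (by lia) rfl rfl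

/-! ### Zeros and coefficients of `H` -/

/-- Exponents match since `n + 1 - 2g = 2(⌊(n+1)/2⌋ - g) + (n+1) % 2`. -/
theorem exists_aeval_sq_oneFaceMapPoly {n : ℕ} (hn : 1 ≤ n) :
    ∃ K : ℚ, 0 < K ∧ ∀ w : ℂ, w ^ ((n + 1) % 2) * aeval (w ^ 2) (oneFaceMapPoly n) =
      K * aeval w (oneFaceRec n) := by
  obtain ⟨K, hK, h⟩ := exists_oneFaceMapCount_eq hn
  refine ⟨K, hK, fun w => ?_⟩
  have hp : oneFaceRec n = ∑ g ∈ Finset.range ((n + 1) / 2 + 1),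
      C ((oneFaceRec n).coeff (n + 1 - 2 * g)) * X ^ (n + 1 - 2 * g) := by
    ext k
    simp only [finsetSum_coeff, coeff_C_mul_X_pow]
    by_cases hk : (oneFaceRec n).coeff k = 0
    · rw [hk, Finset.sum_eq_zero]
      intro g _
      split_ifs with hg
      · rw [← hg, hk]
      · rfl
    · obtain ⟨g, hg⟩ := coeff_oneFaceRec_ne_zero hk
      rw [Finset.sum_eq_single_of_mem g (Finset.mem_range.2 (by lia)), if_pos (by lia)]
      · congr 1
        lia
      · intro g' hg' hne
        have := Finset.mem_range.1 hg'
        exact if_neg (by lia)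
  rw [hp, oneFaceMapPoly, map_sum, map_sum, Finset.mul_sum, Finset.mul_sum]
  refine Finset.sum_congr rfl fun g hg => ?_
  have hg' := Finset.mem_range.1 hg
  have hc := congrArg (Rat.cast : ℚ → ℂ) (h g (n + 1 - 2 * g) (by lia))
  push_cast at hc
  simp only [map_mul, aeval_C, map_pow, aeval_X, map_natCast, hc, eq_ratCast]
  rw [mul_left_comm, ← pow_mul, ← pow_add, mul_assoc]
  congr 4
  lia

theorem roots_oneFaceMapPoly {n : ℕ} (hn : 1 ≤ n) (z : ℂ)
    (hz : aeval z (oneFaceMapPoly n) = 0) : ∃ r : ℝ, r ≤ 0 ∧ z = (r : ℂ) := by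
  obtain ⟨K, hK, h⟩ := exists_aeval_sq_oneFaceMapPoly hn
  obtain ⟨w, rfl⟩ := IsAlgClosed.exists_pow_nat_eq z (n := 2) (by lia)
  have h1 := h w
  rw [hz, mul_zero, eq_comm, mul_eq_zero, or_iff_right (by exact_mod_cast hK.ne')] at h1
  have h2 := re_eq_zero_of_aeval_oneFaceRec h1
  refine ⟨-w.im ^ 2, neg_nonpos.2 (sq_nonneg _), ?_⟩
  apply Complex.ext <;> simp [pow_two, h2]

theorem coeff_oneFaceMapPoly {n g : ℕ} (hg : g ≤ (n + 1) / 2) :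
    (oneFaceMapPoly n).coeff ((n + 1) / 2 - g) = oneFaceMapCount n g := by
  simp only [oneFaceMapPoly, finsetSum_coeff, coeff_C_mul_X_pow]
  rw [Finset.sum_eq_single_of_mem g (Finset.mem_range.2 (by lia)), if_pos rfl]
  intro g' hg' hne
  have := Finset.mem_range.1 hg'
  exact if_neg (by lia)

theorem coeff_oneFaceMapPoly_nonneg (n k : ℕ) : 0 ≤ (oneFaceMapPoly n).coeff k := by
  simp only [oneFaceMapPoly, finsetSum_coeff, coeff_C_mul_X_pow]
  refine Finset.sum_nonneg fun g _ => ?_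
  split_ifs
  exacts [Nat.cast_nonneg _, le_rfl]

theorem mainTheorem7 (n : ℕ) (hn : 1 ≤ n) :
    (∀ z : ℂ, Polynomial.aeval z (oneFaceMapPoly n) = 0 → ∃ r : ℝ, r ≤ 0 ∧ z = (r : ℂ)) ∧
    (∀ g : ℕ, 1 ≤ g →
      oneFaceMapCount n (g - 1) * oneFaceMapCount n (g + 1) ≤ oneFaceMapCount n g ^ 2) := by
  refine ⟨roots_oneFaceMapPoly hn, fun g hg => ?_⟩
  rcases lt_or_ge ((n + 1) / 2) (g + 1) with h | h
  · rw [oneFaceMapCount_eq_zero h, mul_zero]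
    exact Nat.zero_le _
  -- The zero polynomial would vanish at `1`, which is not non-positive.
  have hne : oneFaceMapPoly n ≠ 0 := fun h0 => by
    obtain ⟨r, hr, h1⟩ := roots_oneFaceMapPoly hn 1 (by rw [h0, map_zero])
    have : (1 : ℝ) = r := by exact_mod_cast h1
    linarith
  have hlead : 0 < (oneFaceMapPoly n).leadingCoeff :=
    lt_of_le_of_ne (coeff_oneFaceMapPoly_nonneg n _) (leadingCoeff_ne_zero.2 hne).symm
  -- The genus runs against the exponent, so the lower index belongs to `g + 1`.
  have key := (coeff_nonneg_and_logConcave_of_roots _ hlead (roots_oneFaceMapPoly hn)).2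
    ((n + 1) / 2 - (g + 1)) ((n + 1) / 2 - g) (by lia)
  rw [show (n + 1) / 2 - g + 1 = (n + 1) / 2 - (g - 1) by lia,
    show (n + 1) / 2 - (g + 1) + 1 = (n + 1) / 2 - g by lia, coeff_oneFaceMapPoly h,
    coeff_oneFaceMapPoly (by lia), coeff_oneFaceMapPoly (by lia)] at key
  rw [pow_two, mul_comm]
  exact_mod_cast key
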